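/- Let $A,B,M,N$ be finite non-empty sets and $\Omega=A\times B\times M\times N$. Entity $x$ owns $(\alpha,\mu)\in A\times M$ and sees $\beta$; entity $x'$ (the environment) owns $(\beta,\nu)\in B\times N$ and sees $\alpha$. A generator $\mathbf M$ of $x$ is a family of rates $M^{\alpha'\mu'}_{\alpha\beta\mu}$, non-negative for $(\alpha',\mu')\ne(\alpha,\mu)$ and with $\sum_{\alpha',\mu'}M^{\alpha'\mu'}_{\alpha\beta\mu}=0$; generators $\mathbf N$ of $x'$ are defined symmetrically. Together they give the Markov generator on $\Omega$ $$\mathbf G=\mathbf M+\mathbf N,\qquad G^{\omega'}_{\omega}=\delta^{\beta'\nu'}_{\beta\nu}M^{\alpha'\mu'}_{\alpha\beta\mu}+\delta^{\alpha'\mu'}_{\alpha\mu}N^{\beta'\nu'}_{\alpha\beta\nu},\qquad \varphi(t)=e^{\mathbf Gt}\varphi(0),$$ where $\varphi(0)$ is a probability vector. The system is ergodic if $\bar\varphi=\lim_{T\to\infty}\frac1T\int_0^T\varphi(t)\,dt$ exists and does not depend on $\varphi(0)$. A non-negative objective operator $\Gamma$ assigns to each jump $\omega\to\omega'$ a signal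 $\gamma_{\omega'\omega}\ge 0$ that depends only on the $A\times B\times N$-components of $\omega$ and $\omega'$, with $\gamma_{\omega'\omega}=0$ if these components coincide. The objective value is $$\bar\gamma=\lim_{T\to\infty}\frac1T\int_0^T\sum_{\omega,\omega'}\gamma_{\omega'\omega}G^{\omega'}_{\omega}\varphi^{\omega}(t)\,dt .$$ **Theorem.** Let $\Gamma$ be a non-negative objective operator, $\mathcal P_x=\{\mathbf M_1,\dots,\mathbf M_m\}$ a finite set (of $m$ elements) of generators of $x$, and $\mathcal P_{x'}$ an arbitrary set of generators of $x'$. Suppose that $\mathbf M+\mathbf N$ is ergodic for all $\mathbf M\in\mathcal P_x$ and $\mathbf N\in\mathcal P_{x'}$, and that $\min_{\mathbf M\in\mathcal P_x}\bar\gamma(\mathbf M)=0$ for every $\mathbf N\in\mathcal P_{x'}$, where $\bar\gamma(\mathbf M)$ is the objective value of $\mathbf M+\mathbf N$. Then there is a dynamics $\mathbf M^\star$ of an entity that receives the objective signals, with the same $A$ and $B$ and with private space $M\times[m]$, which simulates the strategies with random switching: in private state $(\mu,i)$ it moves $(\alpha,\mu)$ as $\mathbf M_i$ does and keeps the label $i$,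 except that whenever a jump of the system (made by either entity) carries a positive signal, at that instant the label is reset to a uniformly random element of $[m]$. That is, on $\Omega^\star=A\times B\times(M\times[m])\times N$, for every $\mathbf N\in\mathcal P_{x'}$ the system has the generator $$(G^\star)^{(\omega',j)}_{(\omega,i)}=(\mathbf M_i+\mathbf N)^{\omega'}_{\omega}\cdot\begin{cases}1/m,&\gamma_{\omega'\omega}>0,\\ \delta_{i}^{j},&\gamma_{\omega'\omega}=0.\end{cases}$$ For every $\mathbf N\in\mathcal P_{x'}$ and every initial probability vector on $\Omega^\star$, the objective value of this system exists, and $$\bar\gamma(\mathbf M^\star)=\min_{\mathbf M\in\mathcal P_x}\bar\gamma(\mathbf M)=0 .$$ -/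

import Mathlib

open Filter Topology

noncomputable section

/-- The state at time `t` of the continuous-time Markov dynamics with generator `G` (column
convention: `G ω' ω` is the rate of `ω → ω'`), started in `φ₀`: `φ(t) = exp (t G) φ₀`. -/
def evolve {Ω : Type*} [Fintype Ω] [DecidableEq Ω] (G : Matrix Ω Ω ℝ) (φ₀ : Ω → ℝ) (t : ℝ) :
    Ω → ℝ :=
  (NormedSpace.exp (t • G)).mulVec φ₀

/-- `φbar` is the averaged state `lim_{T → ∞} (1/T) ∫₀ᵀ φ(t) dt` of the dynamics started in `φ₀`. -/
def IsAveragedState {Ω : Type*} [Fintype Ω] [DecidableEq Ω] (G : Matrix Ω Ω ℝ)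
    (φ₀ φbar : Ω → ℝ) : Prop :=
  Tendsto (fun T : ℝ => T⁻¹ • ∫ t in (0 : ℝ)..T, evolve G φ₀ t) atTop (𝓝 φbar)

/-- Ergodicity: the averaged state exists and is the same for all initial probability vectors. -/
def IsErgodic {Ω : Type*} [Fintype Ω] [DecidableEq Ω] (G : Matrix Ω Ω ℝ) : Prop :=
  ∃ φbar : Ω → ℝ, ∀ φ₀ ∈ stdSimplex ℝ Ω, IsAveragedState G φ₀ φbar

/-- The lift `G̃ : H(Ω) → H(Ω × Ω)`, `G̃ |ω⟩ = ∑ ω', G ω' ω |ω' ω⟩`. -/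
def liftGenerator {Ω : Type*} (G : Matrix Ω Ω ℝ) (φ : Ω → ℝ) : Ω × Ω → ℝ :=
  fun p => G p.1 p.2 * φ p.2

/-- Infinitesimal generator of one entity. The entity owns an observable part `Out` and a private
part `Priv`, and it observes in addition the part `In` that the other entity shows. The entry
`rate (o', p') (o, i, p)` is the rate of `(o, p) → (o', p')` while `i` is being observed. -/
structure EntityGenerator (Out In Priv : Type*) [Fintype Out] [Fintype Priv] where
  rate : Matrix (Out × Priv) (Out × In × Priv) ℝ
  rate_nonneg : ∀ o i p o' p', (o', p') ≠ (o, p) → 0 ≤ rate (o', p') (o, i, p)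
  rate_sum : ∀ o i p, ∑ q : Out × Priv, rate q (o, i, p) = 0

/-- The generator `M + N` (sum of the two embeddings) of the two-entity system with configurations
`(α, β, μ, ν)`: the first entity owns `(α, μ)` and sees `β`, the second owns `(β, ν)` and
sees `α`. -/
def systemGenerator {A B M N : Type*} [Fintype A] [DecidableEq A] [Fintype B] [DecidableEq B]
    [Fintype M] [DecidableEq M] [Fintype N] [DecidableEq N]
    (X : EntityGenerator A B M) (Y : EntityGenerator B A N) :
    Matrix (A × B × M × N) (A × B × M × N) ℝ :=
  fun (α', β', μ', ν') (α, β, μ, ν) =>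
    (if β' = β ∧ ν' = ν then X.rate (α', μ') (α, β, μ) else 0) +
      (if α' = α ∧ μ' = μ then Y.rate (β', ν') (β, α, ν) else 0)

/-- An objective operator that depends only on the parts `A`, `B`, `N` of the configuration:
`coeff v' v` is the signal emitted at a jump from `v` to `v'`, and it vanishes for `v' = v`. -/
structure ObjectiveOperator (A B N : Type*) where
  coeff : A × B × N → A × B × N → ℝ
  coeff_self : ∀ v, coeff v v = 0

/-- The signal `Γ |ω' ω⟩` of a jump `ω → ω'` of the whole system, whatever the private
space `M` of the first entity is. -/
def ObjectiveOperator.signal {A B N : Type*} (Γ : ObjectiveOperator A B N) {M : Type*}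
    (ω' ω : A × B × M × N) : ℝ :=
  Γ.coeff (ω'.1, ω'.2.1, ω'.2.2.2) (ω.1, ω.2.1, ω.2.2.2)

/-- `Γ` as an operator on `H(Ω × Ω)`: `Γ = ∑ ω' ω, γ_{ω' ω} ⟨ω' ω|`. -/
def ObjectiveOperator.apply {A B N : Type*} (Γ : ObjectiveOperator A B N) {M : Type*}
    [Fintype A] [Fintype B] [Fintype M] [Fintype N]
    (ψ : (A × B × M × N) × (A × B × M × N) → ℝ) : ℝ :=
  ∑ p, Γ.signal p.1 p.2 * ψ p

/-- The objective value `lim_{T → ∞} (1/T) ∫₀ᵀ Γ G̃ φ(t) dt` exists and equals `v`, for every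
initial probability vector. -/
def HasObjectiveValue {A B M N : Type*} [Fintype A] [DecidableEq A] [Fintype B] [DecidableEq B]
    [Fintype M] [DecidableEq M] [Fintype N] [DecidableEq N]
    (Γ : ObjectiveOperator A B N) (G : Matrix (A × B × M × N) (A × B × M × N) ℝ) (v : ℝ) : Prop :=
  ∀ φ₀ ∈ stdSimplex ℝ (A × B × M × N),
    Tendsto (fun T : ℝ => T⁻¹ * ∫ t in (0 : ℝ)..T, Γ.apply (liftGenerator G (evolve G φ₀ t)))
      atTop (𝓝 v)

/-- A generator of an entity that receives the objective signals. Between signals the entity moves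
as `gen` prescribes. At a jump of the system with signal `s`, its private state is in addition
changed from `p` to `p'` with probability `respond s p p'`; nothing is changed if `s = 0`. -/
structure SignalGenerator (Out In Priv : Type*) [Fintype Out] [Fintype Priv] [DecidableEq Priv] where
  gen : EntityGenerator Out In Priv
  respond : ℝ → Priv → Priv → ℝ
  respond_nonneg : ∀ s p p', 0 ≤ respond s p p'
  respond_sum : ∀ s p, ∑ p', respond s p p' = 1
  respond_zero : ∀ p p', respond 0 p p' = if p' = p then 1 else 0

/-- The generator of the system made of a signal-receiving entity and a second entity `Y`. A jump
`(α, β, μ, ν) → (α', β', μ₁, ν')` occurs at its rate under `X.gen + Y`, and at the same instant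
`μ₁` is replaced by `μ'` with probability `X.respond s μ₁ μ'`, where `s` is the signal of the jump.
On the diagonal `s = 0`, so the diagonal of `X.gen + Y` is left as it is. -/
def SignalGenerator.system {A B M N : Type*} [Fintype A] [DecidableEq A] [Fintype B]
    [DecidableEq B] [Fintype M] [DecidableEq M] [Fintype N] [DecidableEq N]
    (X : SignalGenerator A B M) (Γ : ObjectiveOperator A B N) (Y : EntityGenerator B A N) :
    Matrix (A × B × M × N) (A × B × M × N) ℝ :=
  fun (α', β', μ', ν') ω =>
    ∑ μ₁ : M, systemGenerator X.gen Y (α', β', μ₁, ν') ω *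
      X.respond (Γ.signal (α', β', μ₁, ν') ω) μ₁ μ'

/-- `X` simulates the strategies `S 0, …, S (m-1)` with random switching: in private state `(μ, i)`
it moves as `S i` does and keeps the label `i`; whenever a positive signal occurs, the label is
reset to a uniformly random element of `[m]`. -/
def SignalGenerator.IsRandomSwitching {A B M : Type*} [Fintype A] [Fintype M] [DecidableEq M]
    {m : ℕ} (X : SignalGenerator A B (M × Fin m)) (S : Fin m → EntityGenerator A B M) : Prop :=
  (∀ α β μ i α' μ' i', X.gen.rate (α', (μ', i')) (α, β, (μ, i)) =
      if i' = i then (S i).rate (α', μ') (α, β, μ) else 0) ∧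
    ∀ s > 0, ∀ μ i μ' j, X.respond s (μ, i) (μ', j) = if μ' = μ then (m : ℝ)⁻¹ else 0

end

/-!
The entity that switches at random emits no signal in the long run: as long as signals keep coming,
it is handed the label `i₀` of an optimal strategy again and again, and so at some time holds this
label in a region where that strategy never emits a signal; without a signal the label is never
changed again.

Time averages are handled through stationary distributions. The averaged states of a Markov dynamics
stay in the compact simplex, and all their limit points `π` satisfy `G *ᵥ π = 0`. Hence the objective
value exists and is `0` as soon as the signal rate vanishes on every stationary distribution
(`tendsto_average_of_stationary`), and conversely a strategy of objective value `0` has signal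
rate `0` on each of its stationary distributions (`HasObjectiveValue.signalRate_stationary`).

For stationary distributions three facts about sets closed under the jumps suffice: the support of a
stationary distribution is closed (`IsMarkovGenerator.isClosedUnder_support`), in a stationary state
nothing flows into a closed set (`IsMarkovGenerator.no_inflow`), and every non-empty closed set
carries a stationary distribution (`IsMarkovGenerator.exists_stationary`). They are combined in
`signalRate_randomSwitching_eq_zero`: let `U` consist of the configurations with label `i₀` that are
recurrent for the optimal strategy. If a stationary state of the switching system emitted a signal,
then the part of its support that lies outside `U` and has label `i₀` would be non-empty and closed
under the optimal strategy. It would carry a stationary distribution of this strategy, whose support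
lies in `U`: a contradiction.
-/

open scoped Matrix

/-! ### Closed sets and stationary states of Markov generators -/

/-- A Markov generator in the column convention: `G ω' ω` is the rate of the jump `ω → ω'`. -/
structure IsMarkovGenerator {Ω : Type*} [Fintype Ω] (G : Matrix Ω Ω ℝ) : Prop where
  nonneg : ∀ x y, x ≠ y → 0 ≤ G x y
  sum_col : ∀ y, ∑ x, G x y = 0

/-- A set of states that no jump of positive rate leaves. -/
def IsClosedUnder {Ω : Type*} (G : Matrix Ω Ω ℝ) (S : Set Ω) : Prop :=
  ∀ y ∈ S, ∀ x ∉ S, G x y = 0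

section Flow

variable {Ω : Type*} [Fintype Ω] {G : Matrix Ω Ω ℝ}

lemma IsMarkovGenerator.sum_mulVec (hG : IsMarkovGenerator G) (φ : Ω → ℝ) :
    ∑ x, (G *ᵥ φ) x = 0 := by
  simp only [Matrix.mulVec, dotProduct]
  rw [Finset.sum_comm]
  simp [← Finset.sum_mul, hG.sum_col]

lemma IsMarkovGenerator.isClosedUnder_support (hG : IsMarkovGenerator G) {π : Ω → ℝ}
    (hπ : ∀ x, 0 ≤ π x) (h : G *ᵥ π = 0) : IsClosedUnder G {x | 0 < π x} := by
  intro y hy x hx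
  have hx0 : π x = 0 := le_antisymm (not_lt.1 hx) (hπ x)
  have hterm : ∀ z ∈ Finset.univ, 0 ≤ G x z * π z := by
    intro z _
    rcases eq_or_ne x z with rfl | hxz
    · simp [hx0]
    · exact mul_nonneg (hG.nonneg x z hxz) (hπ z)
  have h1 := (Finset.sum_eq_zero_iff_of_nonneg hterm).1 (congrFun h x) y (Finset.mem_univ y)
  exact (mul_eq_zero.1 h1).resolve_right (ne_of_gt hy)

/-- In a stationary state nothing flows into a closed set `S`, since nothing flows out of it. -/
lemma IsMarkovGenerator.no_inflow (hG : IsMarkovGenerator G) {π : Ω → ℝ}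
    (hπ : ∀ x, 0 ≤ π x) (h : G *ᵥ π = 0) {S : Set Ω} (hS : IsClosedUnder G S) {x y : Ω}
    (hx : x ∈ S) (hy : y ∉ S) (hy0 : 0 < π y) : G x y = 0 := by
  classical
  set F : Finset Ω := Finset.univ.filter (· ∈ S)
  have hF : ∀ z, z ∈ F ↔ z ∈ S := by simp [F]
  have hrate : ∀ z ∉ S, ∀ u ∈ F, 0 ≤ G u z := fun z hz u hu =>
    hG.nonneg u z fun e => hz (e ▸ (hF u).1 hu)
  have hin : ∀ z ∈ S, ∑ u ∈ F, G u z = 0 := by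
    intro z hz
    rw [← hG.sum_col z]
    exact Finset.sum_subset (Finset.subset_univ _)
      fun u _ hu => hS z hz u fun h => hu ((hF u).2 h)
  have htot : ∑ z, (∑ u ∈ F, G u z) * π z = 0 := by
    simp only [Finset.sum_mul]
    rw [Finset.sum_comm]
    exact Finset.sum_eq_zero fun u _ => congrFun h u
  have hterm : ∀ z ∈ Finset.univ, 0 ≤ (∑ u ∈ F, G u z) * π z := by
    intro z _
    by_cases hz : z ∈ S
    · simp [hin z hz]
    · exact mul_nonneg (Finset.sum_nonneg (hrate z hz)) (hπ z)
  have h1 := (Finset.sum_eq_zero_iff_of_nonneg hterm).1 htot y (Finset.mem_univ y)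
  have h2 := (mul_eq_zero.1 h1).resolve_right hy0.ne'
  exact (Finset.sum_eq_zero_iff_of_nonneg (hrate y hy)).1 h2 x ((hF x).2 hx)

/-- A non-empty closed set carries a stationary distribution. The columns of the generator restricted
to the set sum to zero, so it has a kernel vector `v`; then `G |v| ≥ 0` entrywise with total `0`,
so that `|v|` is in the kernel as well. -/
lemma IsMarkovGenerator.exists_stationary (hG : IsMarkovGenerator G) {S : Set Ω}
    (hS : IsClosedUnder G S) (hne : S.Nonempty) :
    ∃ π ∈ stdSimplex ℝ Ω, G *ᵥ π = 0 ∧ ∀ x ∉ S, π x = 0 := by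
  classical
  -- Sums over `Ω` of functions that vanish off `S` are sums over the subtype.
  have hsub : ∀ f : Ω → ℝ, (∀ x ∉ S, f x = 0) → ∑ x : S, f x = ∑ x, f x := by
    intro f hf
    rw [← Finset.sum_subtype (Finset.univ.filter (· ∈ S)) (by simp) f]
    exact Finset.sum_filter_of_ne fun x _ hx => by_contra fun h => hx (hf x h)
  let H : Matrix S S ℝ := G.submatrix Subtype.val Subtype.val
  have hdet : H.det = 0 := by
    refine Matrix.exists_vecMul_eq_zero_iff.1 ⟨fun _ => 1, ?_, ?_⟩
    · obtain ⟨s, hs⟩ := hne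
      exact fun h => one_ne_zero (congrFun h ⟨s, hs⟩)
    · ext y
      have := hsub (fun x => G x y) (fun x hx => hS y y.2 x hx)
      simp [Matrix.vecMul, dotProduct, H, this, hG.sum_col]
  obtain ⟨v, hv0, hv⟩ := Matrix.exists_mulVec_eq_zero_iff.2 hdet
  let w : Ω → ℝ := fun x => if h : x ∈ S then v ⟨x, h⟩ else 0
  have hwS : ∀ x ∉ S, w x = 0 := fun x hx => by simp [w, hx]
  have hwv : ∀ x : S, w x = v x := fun x => by simp [w]
  have hGw : G *ᵥ w = 0 := by
    ext x
    by_cases hx : x ∈ S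
    · have h1 := congrFun hv ⟨x, hx⟩
      simp only [Matrix.mulVec, dotProduct, Pi.zero_apply] at h1 ⊢
      rw [← hsub _ fun y hy => by rw [hwS y hy, mul_zero]]
      simp only [hwv]
      exact h1
    · refine Finset.sum_eq_zero fun y _ => ?_
      by_cases hy : y ∈ S
      · simp [hS y hy x hx]
      · simp [hwS y hy]
  have hsplit : ∀ (u : Ω → ℝ) x, (G *ᵥ u) x = G x x * u x + ∑ y ∈ Finset.univ.erase x, G x y * u y :=
    fun u x => (Finset.add_sum_erase _ (fun y => G x y * u y) (Finset.mem_univ x)).symm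
  have hdiag : ∀ x, G x x ≤ 0 := by
    intro x
    have h1 := hG.sum_col x
    rw [← Finset.add_sum_erase _ _ (Finset.mem_univ x)] at h1
    have h2 : 0 ≤ ∑ y ∈ Finset.univ.erase x, G y x :=
      Finset.sum_nonneg fun y hy => hG.nonneg y x (Finset.ne_of_mem_erase hy)
    linarith
  have habs : ∀ x, 0 ≤ (G *ᵥ fun y => |w y|) x := by
    intro x
    have h1 := congrFun hGw x
    rw [hsplit] at h1 ⊢
    have h2 : |G x x * w x| ≤ ∑ y ∈ Finset.univ.erase x, G x y * |w y| := by
      rw [eq_neg_of_add_eq_zero_left h1, abs_neg]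
      refine (Finset.abs_sum_le_sum_abs _ _).trans_eq (Finset.sum_congr rfl fun y hy => ?_)
      rw [abs_mul, abs_of_nonneg (hG.nonneg x y (Finset.ne_of_mem_erase hy).symm)]
    rw [abs_mul, abs_of_nonpos (hdiag x)] at h2
    linarith
  have hker : (G *ᵥ fun y => |w y|) = 0 := by
    ext x
    exact (Finset.sum_eq_zero_iff_of_nonneg fun x _ => habs x).1
      (hG.sum_mulVec fun y => |w y|) x (Finset.mem_univ x)
  have hpos : 0 < ∑ x, |w x| := by
    obtain ⟨s, hs⟩ := Function.ne_iff.1 hv0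
    refine Finset.sum_pos' (fun _ _ => abs_nonneg _) ⟨s, Finset.mem_univ _, abs_pos.2 ?_⟩
    rw [hwv]; exact hs
  refine ⟨(∑ x, |w x|)⁻¹ • fun y => |w y|, ⟨fun x => ?_, ?_⟩, ?_, fun x hx => ?_⟩
  · exact mul_nonneg (inv_nonneg.2 hpos.le) (abs_nonneg _)
  · simp only [Pi.smul_apply, smul_eq_mul, ← Finset.mul_sum]
    exact inv_mul_cancel₀ hpos.ne'
  · rw [Matrix.mulVec_smul, hker, smul_zero]
  · simp [hwS x hx]

end Flow

/-! ### Evolution, time averages and stationary states -/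

section Evolution

variable {Ω : Type*} [Fintype Ω] [DecidableEq Ω] {G : Matrix Ω Ω ℝ}

open scoped Matrix.Norms.Operator in
lemma hasDerivAt_evolve (G : Matrix Ω Ω ℝ) (φ : Ω → ℝ) (t : ℝ) :
    HasDerivAt (evolve G φ) (G *ᵥ evolve G φ t) t := by
  have h := hasDerivAt_exp_smul_const' (𝕂 := ℝ) G t
  let L : Matrix Ω Ω ℝ →L[ℝ] (Ω → ℝ) :=
    LinearMap.toContinuousLinearMap ((Matrix.mulVecBilin ℝ ℝ).flip φ)
  have e : L (G * NormedSpace.exp (t • G)) = G *ᵥ evolve G φ t := by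
    simp [L, evolve, Matrix.mulVec_mulVec]
  rw [← e]
  exact L.hasFDerivAt.comp_hasDerivAt t h

open scoped Matrix.Norms.Operator in
lemma hasDerivAt_evolve' (G : Matrix Ω Ω ℝ) (φ : Ω → ℝ) (t : ℝ) :
    HasDerivAt (evolve G φ) (evolve G (G *ᵥ φ) t) t := by
  have h := hasDerivAt_exp_smul_const (𝕂 := ℝ) G t
  let L : Matrix Ω Ω ℝ →L[ℝ] (Ω → ℝ) :=
    LinearMap.toContinuousLinearMap ((Matrix.mulVecBilin ℝ ℝ).flip φ)
  have e : L (NormedSpace.exp (t • G) * G) = evolve G (G *ᵥ φ) t := by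
    simp [L, evolve, Matrix.mulVec_mulVec]
  rw [← e]
  exact L.hasFDerivAt.comp_hasDerivAt t h

lemma evolve_zero (G : Matrix Ω Ω ℝ) (φ : Ω → ℝ) : evolve G φ 0 = φ := by
  simp [evolve]

lemma continuous_evolve (G : Matrix Ω Ω ℝ) (φ : Ω → ℝ) : Continuous (evolve G φ) :=
  continuous_iff_continuousAt.2 fun t => (hasDerivAt_evolve G φ t).continuousAt

lemma evolve_of_mulVec_eq_zero {φ : Ω → ℝ} (h : G *ᵥ φ = 0) (t : ℝ) : evolve G φ t = φ := by
  have h' : ∀ s, HasDerivAt (evolve G φ) 0 s := fun s => by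
    simpa [h, evolve] using hasDerivAt_evolve' G φ s
  have := is_const_of_deriv_eq_zero (fun s => (h' s).differentiableAt) (fun s => (h' s).deriv) t 0
  rw [this, evolve_zero]

open scoped Matrix.Norms.Operator in
lemma exp_apply_nonneg_of_nonneg {P : Matrix Ω Ω ℝ} (hP : ∀ x y, 0 ≤ P x y) (x y : Ω) :
    0 ≤ NormedSpace.exp P x y := by
  have hpow : ∀ n : ℕ, ∀ x y, 0 ≤ (P ^ n) x y := by
    intro n
    induction n with
    | zero => intro x y; rw [pow_zero, Matrix.one_apply]; split_ifs <;> norm_num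
    | succ n ih =>
      intro x y
      rw [pow_succ, Matrix.mul_apply]
      exact Finset.sum_nonneg fun z _ => mul_nonneg (ih x z) (hP z y)
  have h := NormedSpace.exp_series_hasSum_exp' (𝕂 := ℝ) P
  have h1 := (Pi.hasSum.1 (Pi.hasSum.1 h x)) y
  exact h1.nonneg fun n => mul_nonneg (by positivity) (hpow n x y)

/-- The semigroup of a Markov generator has non-negative entries, because adding a large multiple of
the identity makes the generator non-negative and only rescales the exponential. -/
lemma IsMarkovGenerator.exp_apply_nonneg (hG : IsMarkovGenerator G) {t : ℝ} (ht : 0 ≤ t)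
    (x y : Ω) : 0 ≤ NormedSpace.exp (t • G) x y := by
  set r : ℝ := ∑ z, |G z z| with hr
  have hP : ∀ x y, 0 ≤ (t • (G + r • (1 : Matrix Ω Ω ℝ))) x y := by
    intro x y
    refine mul_nonneg ht ?_
    rcases eq_or_ne x y with rfl | hxy
    · have h1 : |G x x| ≤ r :=
        Finset.single_le_sum (f := fun z => |G z z|) (fun z _ => abs_nonneg _) (Finset.mem_univ x)
      have := neg_abs_le (G x x)
      simp only [Matrix.add_apply, Matrix.smul_apply, Matrix.one_apply_eq, smul_eq_mul, mul_one]
      linarith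
    · simpa [Matrix.one_apply_ne hxy] using hG.nonneg x y hxy
  have hdecomp : t • G = t • (G + r • (1 : Matrix Ω Ω ℝ)) + Matrix.diagonal (fun _ => -(t * r)) := by
    ext i j
    rcases eq_or_ne i j with rfl | hij
    · simp
    · simp [Matrix.one_apply_ne hij, Matrix.diagonal_apply_ne _ hij]
  have hcomm : Commute (t • (G + r • (1 : Matrix Ω Ω ℝ)))
      (Matrix.diagonal (fun _ : Ω => -(t * r))) := by
    rw [← Matrix.smul_one_eq_diagonal]
    exact (Commute.one_right _).smul_right _
  rw [hdecomp, Matrix.exp_add_of_commute _ _ hcomm, Matrix.exp_diagonal, Matrix.mul_diagonal]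
  refine mul_nonneg (exp_apply_nonneg_of_nonneg hP x y) ?_
  rw [Pi.coe_exp, ← Real.exp_eq_exp_ℝ]
  exact (Real.exp_pos _).le

lemma IsMarkovGenerator.evolve_mem_stdSimplex (hG : IsMarkovGenerator G) {φ : Ω → ℝ}
    (hφ : φ ∈ stdSimplex ℝ Ω) {t : ℝ} (ht : 0 ≤ t) : evolve G φ t ∈ stdSimplex ℝ Ω := by
  refine ⟨fun x => Finset.sum_nonneg fun y _ =>
    mul_nonneg (hG.exp_apply_nonneg ht x y) (hφ.1 y), ?_⟩
  have h' : ∀ s, HasDerivAt (fun s => ∑ x, evolve G φ s x) 0 s := fun s => by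
    have := HasDerivAt.fun_sum (u := Finset.univ)
      fun x _ => (hasDerivAt_pi.1 (hasDerivAt_evolve G φ s)) x
    rwa [hG.sum_mulVec] at this
  have := is_const_of_deriv_eq_zero (fun s => (h' s).differentiableAt) (fun s => (h' s).deriv) t 0
  rw [this, evolve_zero, hφ.2]

lemma average_mem_stdSimplex (hG : IsMarkovGenerator G) {φ : Ω → ℝ}
    (hφ : φ ∈ stdSimplex ℝ Ω) {T : ℝ} (hT : 0 < T) :
    T⁻¹ • ∫ t in (0 : ℝ)..T, evolve G φ t ∈ stdSimplex ℝ Ω := by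
  have hint : IntervalIntegrable (evolve G φ) MeasureTheory.volume 0 T :=
    (continuous_evolve G φ).intervalIntegrable _ _
  have hx : ∀ x, (∫ t in (0 : ℝ)..T, evolve G φ t) x = ∫ t in (0 : ℝ)..T, evolve G φ t x :=
    fun x => ((ContinuousLinearMap.proj (R := ℝ) (φ := fun _ : Ω => ℝ) x).intervalIntegral_comp_comm
      hint).symm
  refine ⟨fun x => ?_, ?_⟩
  · rw [Pi.smul_apply, hx]
    refine smul_nonneg (inv_nonneg.2 hT.le) (intervalIntegral.integral_nonneg hT.le fun t ht => ?_)
    exact (hG.evolve_mem_stdSimplex hφ ht.1).1 x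
  · simp only [Pi.smul_apply, smul_eq_mul, hx]
    rw [← Finset.mul_sum, ← intervalIntegral.integral_finsetSum]
    · rw [intervalIntegral.integral_congr (g := fun _ => (1 : ℝ))]
      · simp [hT.ne']
      · intro t ht
        rw [Set.uIcc_of_le hT.le] at ht
        exact (hG.evolve_mem_stdSimplex hφ ht.1).2
    · intro x _
      exact ((continuous_apply x).comp (continuous_evolve G φ)).intervalIntegrable _ _

/-- A linear functional that vanishes on all stationary distributions has vanishing time average:
by compactness of the simplex the averaged states have limit points, and these are stationary
because `G *ᵥ (T⁻¹ • ∫ φ) = T⁻¹ • (φ(T) - φ(0))`. -/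
lemma tendsto_average_of_stationary (hG : IsMarkovGenerator G) (L : (Ω → ℝ) →L[ℝ] ℝ)
    (hL : ∀ π ∈ stdSimplex ℝ Ω, G *ᵥ π = 0 → L π = 0) {φ : Ω → ℝ} (hφ : φ ∈ stdSimplex ℝ Ω) :
    Tendsto (fun T : ℝ => T⁻¹ * ∫ t in (0 : ℝ)..T, L (evolve G φ t)) atTop (𝓝 0) := by
  have hint : ∀ T, IntervalIntegrable (evolve G φ) MeasureTheory.volume 0 T :=
    fun T => (continuous_evolve G φ).intervalIntegrable _ _
  set a : ℝ → Ω → ℝ := fun T => T⁻¹ • ∫ t in (0 : ℝ)..T, evolve G φ t with ha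
  have hLa : (fun T : ℝ => T⁻¹ * ∫ t in (0 : ℝ)..T, L (evolve G φ t)) = fun T => L (a T) := by
    ext T
    rw [L.intervalIntegral_comp_comm (hint T), ha, map_smul, smul_eq_mul]
  let K : (Ω → ℝ) →L[ℝ] (Ω → ℝ) := LinearMap.toContinuousLinearMap G.mulVecLin
  have hGa : Tendsto (fun T => K (a T)) atTop (𝓝 0) := by
    have e : ∀ T, K (a T) = T⁻¹ • (evolve G φ T - φ) := by
      intro T
      rw [ha, map_smul, ← K.intervalIntegral_comp_comm (hint T)]
      congr 1
      have hK' : IntervalIntegrable (fun t => K (evolve G φ t)) MeasureTheory.volume 0 T :=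
        (K.continuous.comp (continuous_evolve G φ)).intervalIntegrable _ _
      have hd : ∀ t, HasDerivAt (evolve G φ) (K (evolve G φ t)) t := hasDerivAt_evolve G φ
      rw [intervalIntegral.integral_eq_sub_of_hasDerivAt (fun t _ => hd t) hK', evolve_zero]
    simp_rw [e]
    obtain ⟨C, hC⟩ := isBounded_iff_forall_norm_le.1 (isCompact_stdSimplex ℝ Ω).isBounded
    refine tendsto_inv_atTop_zero.zero_smul_isBoundedUnder_le ?_
    refine Filter.isBoundedUnder_of_eventually_le (a := C + C) ?_
    filter_upwards [eventually_ge_atTop 0] with T hT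
    exact (norm_sub_le _ _).trans
      (add_le_add (hC _ (hG.evolve_mem_stdSimplex hφ hT)) (hC _ hφ))
  rw [hLa, tendsto_iff_ultrafilter]
  intro U hU
  have hmem : ∀ᶠ T in (U : Filter ℝ), a T ∈ stdSimplex ℝ Ω :=
    hU ((eventually_gt_atTop 0).mono fun T hT => average_mem_stdSimplex hG hφ hT)
  obtain ⟨π, hπ, hlim⟩ := (isCompact_stdSimplex ℝ Ω).ultrafilter_le_nhds (U.map a)
    (by rw [le_principal_iff]; exact hmem)
  have hlim' : Tendsto a U (𝓝 π) := hlim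
  have h0 : K π = 0 :=
    tendsto_nhds_unique ((K.continuous.tendsto π).comp hlim') (hGa.mono_left hU)
  have := (L.continuous.tendsto π).comp hlim'
  rwa [hL π hπ h0] at this

end Evolution

/-! ### Signals emitted by a two-entity system -/

section SignalRate

variable {A B M N : Type*} {Γ : ObjectiveOperator A B N}

lemma ne_of_signal_pos {x y : A × B × M × N} (h : 0 < Γ.signal x y) : x ≠ y := by
  rintro rfl
  exact h.ne' (Γ.coeff_self _)

variable [Fintype A] [Fintype B] [Fintype M] [Fintype N]
  {G : Matrix (A × B × M × N) (A × B × M × N) ℝ}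

/-- The total signal rate `φ ↦ Γ G̃ φ` as a continuous linear functional of the state. -/
noncomputable def signalRate (Γ : ObjectiveOperator A B N)
    (G : Matrix (A × B × M × N) (A × B × M × N) ℝ) :
    ((A × B × M × N) → ℝ) →L[ℝ] ℝ :=
  LinearMap.toContinuousLinearMap
    { toFun := fun φ => Γ.apply (liftGenerator G φ)
      map_add' := fun φ ψ => by
        simp only [ObjectiveOperator.apply, liftGenerator, Pi.add_apply, mul_add,
          Finset.sum_add_distrib]
      map_smul' := fun r φ => by
        simp only [ObjectiveOperator.apply, liftGenerator, Pi.smul_apply, smul_eq_mul,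
          RingHom.id_apply, Finset.mul_sum]
        exact Finset.sum_congr rfl fun p _ => by ring }

lemma signalRate_apply (φ : (A × B × M × N) → ℝ) :
    signalRate Γ G φ = Γ.apply (liftGenerator G φ) := rfl

lemma signalRate_eq_zero_iff (hΓ : ∀ v' v, 0 ≤ Γ.coeff v' v) (hG : IsMarkovGenerator G)
    {π : (A × B × M × N) → ℝ} (hπ : ∀ x, 0 ≤ π x) :
    signalRate Γ G π = 0 ↔ ∀ x y, 0 < Γ.signal x y → 0 < π y → G x y = 0 := by
  have hsig : ∀ x y : A × B × M × N, 0 ≤ Γ.signal x y := fun _ _ => hΓ _ _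
  have hterm : ∀ p ∈ (Finset.univ : Finset ((A × B × M × N) × (A × B × M × N))),
      0 ≤ Γ.signal p.1 p.2 * (G p.1 p.2 * π p.2) := by
    rintro ⟨x, y⟩ _
    rcases (hsig x y).eq_or_lt with h | h
    · simp [← h]
    · exact mul_nonneg h.le (mul_nonneg (hG.nonneg x y (ne_of_signal_pos h)) (hπ y))
  rw [signalRate_apply]
  unfold ObjectiveOperator.apply liftGenerator
  rw [Finset.sum_eq_zero_iff_of_nonneg hterm]
  refine ⟨fun h x y hs hy => ?_, fun h p _ => ?_⟩
  · have := h (x, y) (Finset.mem_univ _)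
    exact (mul_eq_zero.1 ((mul_eq_zero.1 this).resolve_left hs.ne')).resolve_right hy.ne'
  · rcases (hsig p.1 p.2).eq_or_lt with hs | hs
    · simp [← hs]
    · rcases (hπ p.2).eq_or_lt with hp | hp
      · simp [← hp]
      · simp [h p.1 p.2 hs hp]

end SignalRate

section Objective

variable {A B M N : Type*} [Fintype A] [DecidableEq A] [Fintype B] [DecidableEq B]
  [Fintype M] [DecidableEq M] [Fintype N] [DecidableEq N]
  {Γ : ObjectiveOperator A B N} {G : Matrix (A × B × M × N) (A × B × M × N) ℝ}

lemma isMarkovGenerator_systemGenerator (X : EntityGenerator A B M) (Y : EntityGenerator B A N) :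
    IsMarkovGenerator (systemGenerator X Y) := by
  constructor
  · rintro ⟨α', β', μ', ν'⟩ ⟨α, β, μ, ν⟩ hne
    refine add_nonneg ?_ ?_
    · split_ifs with h
      · obtain ⟨rfl, rfl⟩ := h
        refine X.rate_nonneg _ _ _ _ _ fun e => hne ?_
        simp only [Prod.mk.injEq] at e
        rw [e.1, e.2]
      · exact le_rfl
    · split_ifs with h
      · obtain ⟨rfl, rfl⟩ := h
        refine Y.rate_nonneg _ _ _ _ _ fun e => hne ?_
        simp only [Prod.mk.injEq] at e
        rw [e.1, e.2]
      · exact le_rfl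
  · rintro ⟨α, β, μ, ν⟩
    have hX := X.rate_sum α β μ
    have hY := Y.rate_sum β α ν
    rw [Fintype.sum_prod_type] at hX hY
    simp only [systemGenerator, Fintype.sum_prod_type, Finset.sum_add_distrib, ite_and]
    simp [hX, hY]

/-- The objective value is attained on stationary distributions without taking a time average. -/
lemma HasObjectiveValue.signalRate_stationary {v : ℝ} (h : HasObjectiveValue Γ G v)
    {π : (A × B × M × N) → ℝ} (hπ : π ∈ stdSimplex ℝ (A × B × M × N)) (h0 : G *ᵥ π = 0) :
    signalRate Γ G π = v := by
  refine tendsto_nhds_unique (Tendsto.congr' ?_ tendsto_const_nhds) (h π hπ)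
  filter_upwards [eventually_gt_atTop 0] with T hT
  simp [evolve_of_mulVec_eq_zero h0, signalRate_apply, hT.ne']

lemma hasObjectiveValue_zero_of_stationary (hG : IsMarkovGenerator G)
    (h : ∀ π ∈ stdSimplex ℝ (A × B × M × N), G *ᵥ π = 0 → signalRate Γ G π = 0) :
    HasObjectiveValue Γ G 0 :=
  fun _ hφ => tendsto_average_of_stationary hG (signalRate Γ G) h hφ

end Objective

/-! ### Random switching between strategies -/

section Label

variable {A B M N : Type*} {m : ℕ}

/-- The configuration `ω` with the label `i` added to the private state of the first entity. -/
def withLabel (ω : A × B × M × N) (i : Fin m) : A × B × (M × Fin m) × N :=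
  (ω.1, ω.2.1, (ω.2.2.1, i), ω.2.2.2)

lemma forall_withLabel {p : A × B × (M × Fin m) × N → Prop} :
    (∀ x, p x) ↔ ∀ ω i, p (withLabel ω i) :=
  ⟨fun h _ _ => h _, fun h ⟨α, β, ⟨μ, i⟩, ν⟩ => h (α, β, μ, ν) i⟩

lemma withLabel_inj {ω ω' : A × B × M × N} {i j : Fin m} :
    withLabel ω i = withLabel ω' j ↔ ω = ω' ∧ i = j := by
  obtain ⟨α, β, μ, ν⟩ := ω
  obtain ⟨α', β', μ', ν'⟩ := ω'
  simp only [withLabel, Prod.mk.injEq]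
  tauto

lemma signal_withLabel (Γ : ObjectiveOperator A B N) (ω' ω : A × B × M × N) (j i : Fin m) :
    Γ.signal (withLabel ω' j) (withLabel ω i) = Γ.signal ω' ω := rfl

lemma sum_withLabel [Fintype A] [Fintype B] [Fintype M] [Fintype N]
    (f : A × B × (M × Fin m) × N → ℝ) :
    ∑ x, f x = ∑ ω, ∑ i, f (withLabel ω i) := by
  simp only [Fintype.sum_prod_type, withLabel]
  refine Finset.sum_congr rfl fun α _ => Finset.sum_congr rfl fun β _ =>
    Finset.sum_congr rfl fun μ _ => Finset.sum_comm

end Label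

section Strategy

variable {A B M : Type*} [Fintype A] [Fintype M] [DecidableEq M] {m : ℕ}

/-- The signal-receiving entity that simulates the strategies `S i` with random switching: the
label `i` is kept, except that a positive signal replaces it by a uniformly random one. -/
noncomputable def randomSwitching (S : Fin m → EntityGenerator A B M) :
    SignalGenerator A B (M × Fin m) where
  gen :=
    { rate := fun q r => if q.2.2 = r.2.2.2 then
        (S r.2.2.2).rate (q.1, q.2.1) (r.1, r.2.1, r.2.2.1) else 0
      rate_nonneg := by
        rintro o i ⟨p, k⟩ o' ⟨p', k'⟩ hne
        dsimp only
        split_ifs with h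
        · subst h
          refine (S k').rate_nonneg _ _ _ _ _ fun e => hne ?_
          simp only [Prod.mk.injEq] at e
          rw [e.1, e.2]
        · exact le_rfl
      rate_sum := by
        rintro o i ⟨p, k⟩
        have h := (S k).rate_sum o i p
        rw [Fintype.sum_prod_type] at h
        simp [Fintype.sum_prod_type, h] }
  respond := fun s p p' =>
    if 0 < s then (if p'.1 = p.1 then (m : ℝ)⁻¹ else 0) else if p' = p then 1 else 0
  respond_nonneg := by
    intro s p p'
    split_ifs <;> positivity
  respond_sum := by
    rintro s ⟨μ, i⟩
    -- The label `i` shows that `m` is not zero.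
    have hm : (m : ℝ) ≠ 0 := Nat.cast_ne_zero.2 i.pos.ne'
    split_ifs
    · rw [Fintype.sum_prod_type, Finset.sum_comm]
      simp [hm]
    · simp
  respond_zero := by
    intro p p'
    simp

lemma isRandomSwitching_randomSwitching (S : Fin m → EntityGenerator A B M) :
    (randomSwitching S).IsRandomSwitching S :=
  ⟨fun _ _ _ _ _ _ _ => rfl, fun _ hs _ _ _ _ => if_pos hs⟩

end Strategy

section Switching

variable {A B M N : Type*} [Fintype A] [DecidableEq A] [Fintype B] [DecidableEq B]
  [Fintype M] [DecidableEq M] [Fintype N] [DecidableEq N] {m : ℕ}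

/-- The generator of the system with random switching, in terms of the systems `S i + Y`. -/
lemma system_randomSwitching (S : Fin m → EntityGenerator A B M) (Γ : ObjectiveOperator A B N)
    (Y : EntityGenerator B A N) (ω' ω : A × B × M × N) (j i : Fin m) :
    (randomSwitching S).system Γ Y (withLabel ω' j) (withLabel ω i) =
      systemGenerator (S i) Y ω' ω *
        if 0 < Γ.signal ω' ω then (m : ℝ)⁻¹ else if j = i then 1 else 0 := by
  obtain ⟨α', β', μ', ν'⟩ := ω'
  obtain ⟨α, β, μ, ν⟩ := ω
  have hgen : ∀ μ₁ i₁, systemGenerator (randomSwitching S).gen Y (α', β', (μ₁, i₁), ν')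
      (α, β, (μ, i), ν) =
      if i₁ = i then systemGenerator (S i) Y (α', β', μ₁, ν') (α, β, μ, ν) else 0 := by
    intro μ₁ i₁
    by_cases h : i₁ = i <;> simp [systemGenerator, randomSwitching, h]
  have hsig : ∀ μ₁ i₁, Γ.signal (α', β', (μ₁, i₁), ν') (α, β, (μ, i), ν) =
      Γ.signal (α', β', μ', ν') (α, β, μ, ν) := fun _ _ => rfl
  simp only [SignalGenerator.system, withLabel, Fintype.sum_prod_type, hgen, hsig, ite_mul,
    zero_mul, Finset.sum_ite_eq', Finset.mem_univ, if_true]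
  by_cases hs : 0 < Γ.signal (α', β', μ', ν') (α, β, μ, ν) <;>
    by_cases hj : j = i <;> simp [randomSwitching, hs, hj]

lemma isMarkovGenerator_system_randomSwitching (S : Fin m → EntityGenerator A B M)
    (Γ : ObjectiveOperator A B N) (Y : EntityGenerator B A N) :
    IsMarkovGenerator ((randomSwitching S).system Γ Y) := by
  constructor
  · refine forall_withLabel.2 fun ω' j => forall_withLabel.2 fun ω i hne => ?_
    rw [system_randomSwitching]
    rcases eq_or_ne ω' ω with rfl | h
    · have hs : ¬ 0 < Γ.signal ω' ω' := fun h => ne_of_signal_pos h rfl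
      have hj : j ≠ i := fun h => hne (withLabel_inj.2 ⟨rfl, h⟩)
      simp [hs, hj]
    · refine mul_nonneg ((isMarkovGenerator_systemGenerator (S i) Y).nonneg _ _ h) ?_
      split_ifs <;> positivity
  · refine forall_withLabel.2 fun ω i => ?_
    have hm : (m : ℝ) ≠ 0 := Nat.cast_ne_zero.2 i.pos.ne'
    rw [sum_withLabel, ← (isMarkovGenerator_systemGenerator (S i) Y).sum_col ω]
    refine Finset.sum_congr rfl fun ω' _ => ?_
    simp only [system_randomSwitching, ← Finset.mul_sum]
    split_ifs <;> simp [hm]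

/-- If a single strategy `S i₀` emits no signal in its stationary states, then neither does the
system with random switching. Let `U` be the set of configurations with label `i₀` that are in the
support of some stationary state of `S i₀`; it is closed, and no signal is emitted in it. Hence its
complement `V` within the support of a stationary state of the switching system is closed too. A
jump with a positive signal would start in `V`, and could hand over to the label `i₀` within `V`.
The part of `V` with label `i₀` would then be closed under `S i₀`, hence meet `U`. -/
lemma signalRate_randomSwitching_eq_zero {S : Fin m → EntityGenerator A B M}
    {Γ : ObjectiveOperator A B N} (hΓ : ∀ v' v, 0 ≤ Γ.coeff v' v) {Y : EntityGenerator B A N}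
    {i₀ : Fin m} (h₀ : ∀ π ∈ stdSimplex ℝ (A × B × M × N), systemGenerator (S i₀) Y *ᵥ π = 0 →
      signalRate Γ (systemGenerator (S i₀) Y) π = 0)
    {π : A × B × (M × Fin m) × N → ℝ} (hπ : π ∈ stdSimplex ℝ (A × B × (M × Fin m) × N))
    (hstat : (randomSwitching S).system Γ Y *ᵥ π = 0) :
    signalRate Γ ((randomSwitching S).system Γ Y) π = 0 := by
  set G := systemGenerator (S i₀) Y with hGdef
  set H := (randomSwitching S).system Γ Y with hHdef
  have hG : IsMarkovGenerator G := isMarkovGenerator_systemGenerator _ _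
  have hH : IsMarkovGenerator H := isMarkovGenerator_system_randomSwitching S Γ Y
  have hm : (m : ℝ)⁻¹ ≠ 0 := inv_ne_zero (Nat.cast_ne_zero.2 i₀.pos.ne')
  let U : Set (A × B × (M × Fin m) × N) :=
    {x | ∃ ρ ∈ stdSimplex ℝ (A × B × M × N), G *ᵥ ρ = 0 ∧ ∃ η, 0 < ρ η ∧ x = withLabel η i₀}
  have hU_signal : ∀ y ∈ U, ∀ x, 0 < Γ.signal x y → H x y = 0 := by
    rintro _ ⟨ρ, hρ, hρ0, η, hη, rfl⟩
    refine forall_withLabel.2 fun ω' j hs => ?_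
    rw [signal_withLabel] at hs
    have := (signalRate_eq_zero_iff hΓ hG hρ.1).1 (h₀ ρ hρ hρ0) ω' η hs hη
    rw [hHdef, system_randomSwitching, ← hGdef, this, zero_mul]
  have hU : IsClosedUnder H U := by
    rintro y hyU
    refine forall_withLabel.2 fun ω' j hx => ?_
    by_cases hs : 0 < Γ.signal (withLabel ω' j) y
    · exact hU_signal y hyU _ hs
    obtain ⟨ρ, hρ, hρ0, η, hη, rfl⟩ := hyU
    rw [signal_withLabel] at hs
    rw [hHdef, system_randomSwitching, if_neg hs, ← hGdef]
    split_ifs with hj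
    · have : ω' ∉ {z | 0 < ρ z} := fun h => hx ⟨ρ, hρ, hρ0, ω', h, by rw [hj]⟩
      rw [hG.isClosedUnder_support hρ.1 hρ0 η hη ω' this, zero_mul]
    · rw [mul_zero]
  have hV : ∀ y ∉ U, 0 < π y → ∀ x, H x y ≠ 0 → x ∉ U ∧ 0 < π x := by
    intro y hyU hy x hxy
    refine ⟨fun hx => hxy (hH.no_inflow hπ.1 hstat hU hx hyU hy), ?_⟩
    by_contra hx
    exact hxy (hH.isClosedUnder_support hπ.1 hstat y hy x hx)
  rw [signalRate_eq_zero_iff hΓ hH hπ.1]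
  refine forall_withLabel.2 fun ω' j => forall_withLabel.2 fun ω i hs hpos => ?_
  by_contra hne
  have hnU : withLabel ω i ∉ U := fun h => hne (hU_signal _ h _ hs)
  rw [signal_withLabel] at hs
  have hne' : H (withLabel ω' i₀) (withLabel ω i) ≠ 0 := by
    -- The new label is uniformly distributed, so all labels are reached at the same rate.
    rw [hHdef, system_randomSwitching, if_pos hs] at hne ⊢
    exact hne
  let W : Set (A × B × M × N) := {η | withLabel η i₀ ∉ U ∧ 0 < π (withLabel η i₀)}
  have hW : IsClosedUnder G W := by
    intro y hy x hx
    by_contra hxy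
    refine hx (hV _ hy.1 hy.2 _ ?_)
    rw [hHdef, system_randomSwitching, ← hGdef]
    rw [if_pos rfl]
    refine mul_ne_zero hxy ?_
    split_ifs
    · exact hm
    · exact one_ne_zero
  obtain ⟨ρ, hρ, hρ0, hρW⟩ := hG.exists_stationary hW ⟨ω', hV _ hnU hpos _ hne'⟩
  obtain ⟨η, hη⟩ : ∃ η, 0 < ρ η := by
    by_contra! hle
    have := Finset.sum_nonpos fun x (_ : x ∈ Finset.univ) => hle x
    rw [hρ.2] at this
    exact absurd this (by norm_num)
  have hηW : η ∈ W := by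
    by_contra h
    exact hη.ne' (hρW η h)
  exact hηW.1 ⟨ρ, hρ, hρ0, η, hη, rfl⟩

end Switching

theorem mainTheorem7 {A B M N : Type*}
    [Fintype A] [DecidableEq A] [Nonempty A] [Fintype B] [DecidableEq B] [Nonempty B]
    [Fintype M] [DecidableEq M] [Nonempty M] [Fintype N] [DecidableEq N] [Nonempty N]
    (Γ : ObjectiveOperator A B N) (hΓ : ∀ v' v, 0 ≤ Γ.coeff v' v)
    (Px : Set (EntityGenerator A B M)) (Py : Set (EntityGenerator B A N))
    {m : ℕ} (e : Fin m ≃ Px)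
    (hergodic : ∀ X ∈ Px, ∀ Y ∈ Py, IsErgodic (systemGenerator X Y))
    (hmin : ∀ Y ∈ Py,
      IsLeast {v : ℝ | ∃ X ∈ Px, HasObjectiveValue Γ (systemGenerator X Y) v} 0) :
    ∃ Xstar : SignalGenerator A B (M × Fin m),
      Xstar.IsRandomSwitching (fun i => (e i : EntityGenerator A B M)) ∧
      ∀ Y ∈ Py, HasObjectiveValue Γ (Xstar.system Γ Y) 0 ∧
        IsLeast {v : ℝ | ∃ X ∈ Px, HasObjectiveValue Γ (systemGenerator X Y) v} 0 := by
  refine ⟨randomSwitching fun i => e i, isRandomSwitching_randomSwitching _, fun Y hY =>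
    ⟨?_, hmin Y hY⟩⟩
  obtain ⟨X, hX, hval⟩ := (hmin Y hY).1
  refine hasObjectiveValue_zero_of_stationary (isMarkovGenerator_system_randomSwitching _ Γ Y)
    fun π hπ hstat => signalRate_randomSwitching_eq_zero hΓ (i₀ := e.symm ⟨X, hX⟩) ?_ hπ hstat
  rw [e.apply_symm_apply]
  exact fun ρ hρ hρ0 => hval.signalRate_stationary hρ hρ0
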